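/- Let $G$ be a second countable, Hausdorff, locally compact abelian group with Haar measure $\mu$ and dual group $\widehat G$, and let $n$ be a positive integer. Let $L^2(G,\mathbb{C}^{n\times n})$ be the space of matrix-valued functions $\mathbf f=[f_{ij}]_{1\le i,j\le n}$ with all $f_{ij}\in L^2(G)$, with the Frobenius norm $\|\mathbf f\|^2=\sum_{i,j}\int_G|f_{ij}|^2\,d\mu$ and the matrix-valued inner product $\langle \mathbf f,\mathbf g\rangle=\int_G \mathbf f(x)\mathbf g(x)^*\,d\mu(x)\in\mathbb{C}^{n\times n}$. It is a Hilbert space for the inner product $\operatorname{tr}\langle \mathbf f,\mathbf g\rangle$, and $\Theta^*$ denotes the adjoint of a bounded linear operator $\Theta$ for this inner product. The operator $\Theta$ is *hyponormal* if $\|\Theta^*\mathbf f\|\le\|\Theta\mathbf f\|$ for all $\mathbf f$, and *adjointable for the matrix-valued inner product* if $\langle\Theta\mathbf f,\mathbf g\rangle=\langle\mathbf f,\Theta^*\mathbf g\rangle$ for all $\mathbf f,\mathbf g$. For $\lambda_0>0$, a countable family $\{\mathbf f_k\}_{k\in I}$ in $L^2(G,\mathbb{C}^{n\times n})$ is a *matrix-valued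 $\lambda_0$-$(\Theta,\Theta^*)$-tight frame* if $$\lambda_0\|\Theta^*\mathbf f\|^2\le\sum_{k\in I}\|\langle\mathbf f_k,\mathbf f\rangle\|^2\le\lambda_0\|\Theta\mathbf f\|^2\qquad\text{for all }\mathbf f\in L^2(G,\mathbb{C}^{n\times n}),$$ where matrices carry the Frobenius norm; it is a *matrix-valued $\lambda_0$-tight frame* if this holds with the identity in place of $\Theta$. **Theorem.** Let $\Theta$ be a hyponormal bounded linear operator on $L^2(G,\mathbb{C}^{n\times n})$ which is adjointable for the matrix-valued inner product, and let $\lambda_0>0$. Then there exists a matrix-valued $\lambda_0$-$(\Theta,\Theta^*)$-tight frame for $L^2(G,\mathbb{C}^{n\times n})$. Moreover, let $\Lambda_0\subset\mathbb{N}$ be finite, let $\Lambda\subset G$ and $\Lambda'\subset\widehat G$ be lattices (discrete cocompact subgroups), let $B$ and $C$ be topological automorphisms of $G$ and $\widehat G$, let $T_a f(x)=f(xa^{-1})$ and $E_\eta f(x)=\eta(x)f(x)$, and let $\phi_l\in L^2(G)$ $(l\in\Lambda_0)$ be such that $\{E_{Cm}T_{Bk}\phi_l\}_{l\in\Lambda_0,k\in\Lambda,m\in\Lambda'}$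 is a Parseval frame for $L^2(G)$. Put $\Phi_l=\operatorname{diag}(\sqrt{\lambda_0}\,\phi_l,\dots,\sqrt{\lambda_0}\,\phi_l)$. Then $\{E_{Cm}T_{Bk}\Phi_l\}_{l\in\Lambda_0,k\in\Lambda,m\in\Lambda'}$ is a matrix-valued $\lambda_0$-tight Gabor frame for $L^2(G,\mathbb{C}^{n\times n})$, and $\{\Theta E_{Cm}T_{Bk}\Phi_l\}_{l\in\Lambda_0,k\in\Lambda,m\in\Lambda'}$ is a matrix-valued $\lambda_0$-$(\Theta,\Theta^*)$-tight frame for $L^2(G,\mathbb{C}^{n\times n})$. -/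

import Mathlib

open MeasureTheory
open scoped ENNReal Matrix InnerProductSpace

attribute [local instance] Matrix.frobeniusNormedAddCommGroup

/-- A lattice in a topological group: a discrete cocompact subgroup. -/
def IsLattice {H : Type*} [CommGroup H] [TopologicalSpace H] (L : Subgroup H) : Prop :=
  DiscreteTopology L ∧ CompactSpace (H ⧸ L)

set_option linter.unusedSectionVars false

noncomputable section

namespace MatGabor

universe u

variable {G : Type u} [CommGroup G] [TopologicalSpace G] [IsTopologicalGroup G]
  [SecondCountableTopology G] [MeasurableSpace G] [BorelSpace G]

/-- The scalar space `L²(G)`. -/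
abbrev L2 (μ : Measure G) : Type u := Lp ℂ 2 μ

/-- The Hilbert space `L²(G, ℂ^{n×n})`: matrices with entries in `L²(G)`, with the Frobenius
norm `‖f‖² = ∑ i j, ‖f i j‖²`. The `(i, j)` entry of `f` is `f (i, j)`. -/
abbrev L2Mat (μ : Measure G) (n : ℕ) : Type u :=
  PiLp 2 (fun _ : Fin n × Fin n => L2 μ)

section Space

variable {μ : Measure G} {n : ℕ}

/-- The matrix `f(x)`. -/
def valueAt (f : L2Mat μ n) (x : G) : Matrix (Fin n) (Fin n) ℂ :=
  Matrix.of fun i j => (f (i, j) : G → ℂ) x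

/-- The matrix-valued inner product `⟨f, g⟩ = ∫ f(x) g(x)^* dμ(x)`, integrated entrywise. -/
def matInner (f g : L2Mat μ n) : Matrix (Fin n) (Fin n) ℂ :=
  Matrix.of fun i j => ∫ x, (valueAt f x * (valueAt g x)ᴴ) i j ∂μ

theorem matInner_apply (f g : L2Mat μ n) (i j : Fin n) :
    matInner f g i j = ∑ k, inner ℂ (g (j, k)) (f (i, k)) := by
  simp only [matInner, valueAt, Matrix.of_apply, Matrix.mul_apply, Matrix.conjTranspose_apply]
  rw [integral_finsetSum]
  · refine Finset.sum_congr rfl fun k _ => ?_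
    rw [L2.inner_def]
    rfl
  · intro k _
    exact L2.integrable_inner (𝕜 := ℂ) (g (j, k)) (f (i, k))

/-- The trace of the matrix-valued inner product is the Hilbert space inner product of `L2Mat`
(which in Mathlib is linear in its second variable). Hence `ContinuousLinearMap.adjoint` on
`L2Mat` is the adjoint with respect to `tr ⟨·, ·⟩`. -/
theorem trace_matInner (f g : L2Mat μ n) : (matInner f g).trace = inner ℂ g f := by
  simp only [Matrix.trace, Matrix.diag, matInner_apply, PiLp.inner_apply]
  rw [Fintype.sum_prod_type]

/-- `Θ` is hyponormal: `‖Θ^* f‖ ≤ ‖Θ f‖` for all `f`. -/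
def IsHyponormal (Θ : L2Mat μ n →L[ℂ] L2Mat μ n) : Prop :=
  ∀ f, ‖ContinuousLinearMap.adjoint Θ f‖ ≤ ‖Θ f‖

/-- `Θ` is adjointable for the matrix-valued inner product: `⟨Θ f, g⟩ = ⟨f, Θ^* g⟩`. -/
def IsMatAdjointable (Θ : L2Mat μ n →L[ℂ] L2Mat μ n) : Prop :=
  ∀ f g, matInner (Θ f) g = matInner f (ContinuousLinearMap.adjoint Θ g)

/-- A scalar Parseval frame for `L²(G)`. -/
def IsParsevalFrame {ι : Type*} (F : ι → L2 μ) : Prop :=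
  Countable ι ∧ ∀ f : L2 μ, HasSum (fun p => ‖inner ℂ (F p) f‖ ^ 2) (‖f‖ ^ 2)

/-- A matrix-valued frame for `L²(G, ℂ^{n×n})` with bounds `a`, `b`; the norm of
`⟨F p, f⟩` is the Frobenius norm. -/
def IsMatFrame {ι : Type*} (a b : ℝ) (F : ι → L2Mat μ n) : Prop :=
  Countable ι ∧ 0 < a ∧ 0 < b ∧ ∀ f : L2Mat μ n,
    Summable (fun p => ‖matInner (F p) f‖ ^ 2) ∧
    a * ‖f‖ ^ 2 ≤ ∑' p, ‖matInner (F p) f‖ ^ 2 ∧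
    ∑' p, ‖matInner (F p) f‖ ^ 2 ≤ b * ‖f‖ ^ 2

/-- A matrix-valued `(Θ, Θ^*)`-frame for `L²(G, ℂ^{n×n})` with bounds `a`, `b`. -/
def IsThetaFrame {ι : Type*} (Θ : L2Mat μ n →L[ℂ] L2Mat μ n) (a b : ℝ)
    (F : ι → L2Mat μ n) : Prop :=
  Countable ι ∧ 0 < a ∧ 0 < b ∧ ∀ f : L2Mat μ n,
    Summable (fun p => ‖matInner (F p) f‖ ^ 2) ∧
    a * ‖ContinuousLinearMap.adjoint Θ f‖ ^ 2 ≤ ∑' p, ‖matInner (F p) f‖ ^ 2 ∧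
    ∑' p, ‖matInner (F p) f‖ ^ 2 ≤ b * ‖Θ f‖ ^ 2

/-- A matrix-valued `c`-tight frame. -/
def IsTightMatFrame {ι : Type*} (c : ℝ) (F : ι → L2Mat μ n) : Prop := IsMatFrame c c F

/-- A matrix-valued `c`-`(Θ, Θ^*)`-tight frame. -/
def IsTightThetaFrame {ι : Type*} (Θ : L2Mat μ n →L[ℂ] L2Mat μ n) (c : ℝ)
    (F : ι → L2Mat μ n) : Prop := IsThetaFrame Θ c c F

/-- The matrix-valued function with `φ` on the diagonal and `0` elsewhere. -/
def diagWindow (n : ℕ) (φ : L2 μ) : L2Mat μ n :=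
  WithLp.toLp 2 fun p => if p.1 = p.2 then φ else 0

theorem memLp_modulation (η : PontryaginDual G) (f : L2 μ) :
    MemLp (fun x => (η x : ℂ) * f x) 2 μ := by
  have hη : Continuous fun x : G => (η x : ℂ) :=
    continuous_subtype_val.comp (map_continuous η)
  refine (Lp.memLp f).of_le (hη.aestronglyMeasurable.mul (Lp.aestronglyMeasurable f)) ?_
  exact Filter.Eventually.of_forall fun x => by rw [norm_mul, Circle.norm_coe, one_mul]

/-- Modulation on `L²(G)`: `(E_η f)(x) = η(x) f(x)`. -/
def modulation (η : PontryaginDual G) (f : L2 μ) : L2 μ := (memLp_modulation η f).toLp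

/-- Translation on `L²(G)`: `(T_a f)(x) = f(x a⁻¹)`. -/
def translation [μ.IsHaarMeasure] (a : G) (f : L2 μ) : L2 μ :=
  Lp.compMeasurePreserving (fun x => x * a⁻¹) (measurePreserving_mul_right μ a⁻¹) f

/-- Modulation of matrix-valued functions: `(E_η f)(x) = η(x) f(x)`. -/
def matModulation (η : PontryaginDual G) (f : L2Mat μ n) : L2Mat μ n :=
  WithLp.toLp 2 fun p => modulation η (f p)

/-- Translation of matrix-valued functions: `(T_a f)(x) = f(x a⁻¹)`. -/
def matTranslation [μ.IsHaarMeasure] (a : G) (f : L2Mat μ n) : L2Mat μ n :=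
  WithLp.toLp 2 fun p => translation a (f p)

variable [μ.IsHaarMeasure] {Λ₀ : Finset ℕ}

/-- The Gabor system `E_{Cm} T_{Bk} φ_l`, `l ∈ Λ₀`, `k ∈ Λ`, `m ∈ Λ'`, in `L²(G)`. -/
def gaborSystem (Λ : Subgroup G) (Λ' : Subgroup (PontryaginDual G)) (B : G ≃ₜ* G)
    (C : PontryaginDual G ≃ₜ* PontryaginDual G) (φ : Λ₀ → L2 μ) :
    Λ₀ × Λ × Λ' → L2 μ :=
  fun p => modulation (C p.2.2) (translation (B p.2.1) (φ p.1))

/-- The matrix-valued Gabor system `E_{Cm} T_{Bk} Φ_l`, `l ∈ Λ₀`, `k ∈ Λ`, `m ∈ Λ'`. -/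
def matGaborSystem (Λ : Subgroup G) (Λ' : Subgroup (PontryaginDual G)) (B : G ≃ₜ* G)
    (C : PontryaginDual G ≃ₜ* PontryaginDual G) (Φ : Λ₀ → L2Mat μ n) :
    Λ₀ × Λ × Λ' → L2Mat μ n :=
  fun p => matModulation (C p.2.2) (matTranslation (B p.2.1) (Φ p.1))

end Space

end MatGabor

end

/-!
A diagonal window turns the matrix-valued inner product into a table of scalar ones: the entries of
`⟨diag(φ, …, φ), f⟩` are the numbers `⟨φ, f i j⟩` (`matInner_diagWindow_apply`). Summing their
squared moduli over a scalar Parseval frame `(ψ p)` of `L²(G)` therefore gives `‖f i j‖²` for each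
entry, so the windows `diag(√c ψ p, …, √c ψ p)` satisfy the matrix-valued identity
`∑ p, ‖⟨Ψ p, f⟩‖² = c ‖f‖²` (`hasSum_matInner_diagWindow`).

Adjointability gives `⟨Θ Ψ p, f⟩ = ⟨Ψ p, Θ^* f⟩`, hence `∑ p, ‖⟨Θ Ψ p, f⟩‖² = c ‖Θ^* f‖²`. This
is the lower bound of a tight `(Θ, Θ^*)`-frame, with equality, and hyponormality gives the upper
bound (`IsParsevalFrame.isTightThetaFrame`).

Existence follows by taking for `ψ` an orthonormal basis of the separable space `L²(G)`
(`exists_isParsevalFrame_nat`). For Gabor systems, modulations and translations act entrywise and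
linearly, so the matrix-valued system generated by `diag(√c φ, …, √c φ)` consists of the diagonal
windows of the scalar system (`matGaborSystem_diagWindow`).
-/

/-- An orthonormal family in a separable space is countable: the balls of radius `1/2` around its
members are pairwise disjoint, as the members lie at distance `√2` from each other. -/
theorem Orthonormal.countable_of_separableSpace {𝕜 E ι : Type*} [RCLike 𝕜] [NormedAddCommGroup E]
    [InnerProductSpace 𝕜 E] [TopologicalSpace.SeparableSpace E] {v : ι → E}
    (hv : Orthonormal 𝕜 v) : Countable ι := by
  rw [← Set.countable_univ_iff]
  refine Set.PairwiseDisjoint.countable_of_isOpen (s := fun i => Metric.ball (v i) (1 / 2)) ?_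
    (fun _ _ => Metric.isOpen_ball) fun _ _ => Metric.nonempty_ball.2 (by norm_num)
  intro i _ j _ hij
  refine Metric.ball_disjoint_ball ?_
  have h : ‖v i - v j‖ ^ 2 = 2 := by
    rw [norm_sub_sq (𝕜 := 𝕜), hv.inner_eq_zero hij, hv.norm_eq_one, hv.norm_eq_one]
    norm_num
  rw [dist_eq_norm]
  nlinarith [norm_nonneg (v i - v j)]

theorem Matrix.frobenius_norm_sq {m n α : Type*} [Fintype m] [Fintype n] [NormedAddCommGroup α]
    (A : Matrix m n α) : ‖A‖ ^ 2 = ∑ i, ∑ j, ‖A i j‖ ^ 2 := by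
  rw [Matrix.frobenius_norm_def, ← Real.sqrt_eq_rpow, Real.sq_sqrt (by positivity)]
  simp

/-- Parseval's identity for a Hilbert basis. -/
theorem HilbertBasis.hasSum_norm_inner_sq {𝕜 E ι : Type*} [RCLike 𝕜] [NormedAddCommGroup E]
    [InnerProductSpace 𝕜 E] (b : HilbertBasis ι 𝕜 E) (x : E) :
    HasSum (fun i => ‖inner 𝕜 (b i) x‖ ^ 2) (‖x‖ ^ 2) := by
  have h := (b.hasSum_inner_mul_inner x x).mapL RCLike.reCLM
  rw [RCLike.reCLM_apply, inner_self_eq_norm_sq] at h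
  refine h.congr_fun fun i => ?_
  rw [inner_mul_symm_re_eq_norm, norm_mul, norm_inner_symm x, sq]

namespace MatGabor

variable {G : Type*} [CommGroup G] [TopologicalSpace G] [IsTopologicalGroup G]
  [SecondCountableTopology G] [MeasurableSpace G] [BorelSpace G] {μ : Measure G} {n : ℕ}

/-! ### Diagonal windows -/

theorem matInner_diagWindow_apply (φ : L2 μ) (f : L2Mat μ n) (i j : Fin n) :
    matInner (diagWindow n φ) f i j = inner ℂ (f (j, i)) φ := by
  rw [matInner_apply, Finset.sum_eq_single i]
  · simp [diagWindow]
  · intro k _ hk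
    simp [diagWindow, hk.symm]
  · simp

/-- The diagonal windows of a scalar Parseval frame, scaled by `√c`, satisfy the matrix-valued
Parseval identity with constant `c`. -/
theorem hasSum_matInner_diagWindow {ι : Type*} {F : ι → L2 μ} (hF : IsParsevalFrame F) {c : ℝ}
    (hc : 0 ≤ c) (f : L2Mat μ n) :
    HasSum (fun p => ‖matInner (diagWindow n ((Real.sqrt c : ℂ) • F p)) f‖ ^ 2)
      (c * ‖f‖ ^ 2) := by
  have h : HasSum (fun p => ∑ i : Fin n, ∑ j : Fin n, c * ‖inner ℂ (F p) (f (j, i))‖ ^ 2)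
      (∑ i : Fin n, ∑ j : Fin n, c * ‖f (j, i)‖ ^ 2) :=
    hasSum_sum fun i _ => hasSum_sum fun j _ => (hF.2 (f (j, i))).mul_left c
  have hf : c * ‖f‖ ^ 2 = ∑ i : Fin n, ∑ j : Fin n, c * ‖f (j, i)‖ ^ 2 := by
    rw [PiLp.norm_sq_eq_of_L2, Fintype.sum_prod_type, Finset.sum_comm, Finset.mul_sum]
    simp only [Finset.mul_sum]
  rw [hf]
  refine h.congr_fun fun p => ?_
  rw [Matrix.frobenius_norm_sq]
  refine Finset.sum_congr rfl fun i _ => Finset.sum_congr rfl fun j _ => ?_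
  rw [matInner_diagWindow_apply, inner_smul_right, norm_mul, mul_pow, Complex.norm_real,
    Real.norm_eq_abs, sq_abs, Real.sq_sqrt hc, norm_inner_symm]

theorem IsParsevalFrame.isTightMatFrame {ι : Type*} {F : ι → L2 μ} (hF : IsParsevalFrame F)
    {c : ℝ} (hc : 0 < c) :
    IsTightMatFrame c fun p => diagWindow n ((Real.sqrt c : ℂ) • F p) := by
  refine ⟨hF.1, hc, hc, fun f => ?_⟩
  have h := hasSum_matInner_diagWindow hF hc.le f
  exact ⟨h.summable, h.tsum_eq.ge, h.tsum_eq.le⟩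

theorem IsParsevalFrame.isTightThetaFrame {ι : Type*} {F : ι → L2 μ} (hF : IsParsevalFrame F)
    {Θ : L2Mat μ n →L[ℂ] L2Mat μ n} (hΘ : IsHyponormal Θ) (hadj : IsMatAdjointable Θ)
    {c : ℝ} (hc : 0 < c) :
    IsTightThetaFrame Θ c fun p => Θ (diagWindow n ((Real.sqrt c : ℂ) • F p)) := by
  refine ⟨hF.1, hc, hc, fun f => ?_⟩
  have h := hasSum_matInner_diagWindow hF hc.le (ContinuousLinearMap.adjoint Θ f)
  simp only [← hadj _ f] at h
  refine ⟨h.summable, h.tsum_eq.ge, h.tsum_eq.le.trans ?_⟩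
  have := hΘ f
  gcongr

/-! ### Existence of scalar Parseval frames -/

/-- The frame is an orthonormal basis of the separable space `L²(G)`, indexed by naturals and
padded with zeros. -/
theorem exists_isParsevalFrame_nat [SigmaFinite μ] :
    ∃ F : ℕ → L2 μ, IsParsevalFrame F := by
  obtain ⟨w, b, -⟩ := exists_hilbertBasis ℂ (L2 μ)
  -- The separability of `L²` is an instance only under `Fact (2 ≠ ∞)`.
  have : Fact ((2 : ℝ≥0∞) ≠ ∞) := ⟨by norm_num⟩
  have : Countable w := b.orthonormal.countable_of_separableSpace
  obtain ⟨e, he⟩ := exists_injective_nat w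
  refine ⟨Function.extend e b 0, inferInstance, fun f => ?_⟩
  refine ((hasSum_extend_zero he).2 (b.hasSum_norm_inner_sq f)).congr_fun fun k => ?_
  by_cases hk : ∃ a, e a = k
  · obtain ⟨a, rfl⟩ := hk
    rw [he.extend_apply, he.extend_apply]
  · rw [Function.extend_apply' _ _ _ hk, Function.extend_apply' _ _ _ hk]
    simp

/-! ### Gabor systems generated by diagonal windows -/

theorem modulation_smul (η : PontryaginDual G) (s : ℂ) (f : L2 μ) :
    modulation η (s • f) = s • modulation η f := by
  refine Lp.ext ?_
  filter_upwards [(memLp_modulation η (s • f)).coeFn_toLp, (memLp_modulation η f).coeFn_toLp,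
    Lp.coeFn_smul s f, Lp.coeFn_smul s (modulation η f)] with x h₁ h₂ h₃ h₄
  rw [h₄, Pi.smul_apply]
  simp only [modulation]
  rw [h₁, h₂, h₃, Pi.smul_apply, smul_eq_mul, smul_eq_mul, mul_left_comm]

theorem modulation_zero (η : PontryaginDual G) : modulation η (0 : L2 μ) = 0 := by
  simpa using modulation_smul η 0 (0 : L2 μ)

variable [μ.IsHaarMeasure]

theorem translation_smul (a : G) (s : ℂ) (f : L2 μ) :
    translation a (s • f) = s • translation a f :=
  map_smul (Lp.compMeasurePreservingₗ ℂ _ (measurePreserving_mul_right μ a⁻¹)) s f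

theorem translation_zero (a : G) : translation a (0 : L2 μ) = 0 :=
  map_zero (Lp.compMeasurePreserving _ (measurePreserving_mul_right μ a⁻¹))

theorem matModulation_diagWindow (η : PontryaginDual G) (φ : L2 μ) :
    matModulation η (diagWindow n φ) = diagWindow n (modulation η φ) := by
  ext1 p
  simp only [matModulation, diagWindow]
  split_ifs
  · rfl
  · exact modulation_zero η

theorem matTranslation_diagWindow (a : G) (φ : L2 μ) :
    matTranslation a (diagWindow n φ) = diagWindow n (translation a φ) := by
  ext1 p
  simp only [matTranslation, diagWindow]
  split_ifs
  · rfl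
  · exact translation_zero a

theorem matGaborSystem_diagWindow {Λ₀ : Finset ℕ} (Λ : Subgroup G)
    (Λ' : Subgroup (PontryaginDual G)) (B : G ≃ₜ* G)
    (C : PontryaginDual G ≃ₜ* PontryaginDual G) (s : ℂ) (φ : Λ₀ → L2 μ) :
    matGaborSystem Λ Λ' B C (fun l => diagWindow n (s • φ l)) =
      fun p => diagWindow n (s • gaborSystem Λ Λ' B C φ p) := by
  funext p
  rw [matGaborSystem, matTranslation_diagWindow, matModulation_diagWindow, translation_smul,
    modulation_smul, gaborSystem]

end MatGabor

theorem mainTheorem2 {G : Type*} [CommGroup G] [TopologicalSpace G] [IsTopologicalGroup G]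
    [T2Space G] [LocallyCompactSpace G] [SecondCountableTopology G]
    [MeasurableSpace G] [BorelSpace G] (μ : Measure G) [μ.IsHaarMeasure] (n : ℕ)
    (Θ : MatGabor.L2Mat μ n →L[ℂ] MatGabor.L2Mat μ n)
    (hΘ : MatGabor.IsHyponormal Θ) (hadj : MatGabor.IsMatAdjointable Θ)
    (c : ℝ) (hc : 0 < c) :
    (∃ F : ℕ → MatGabor.L2Mat μ n, MatGabor.IsTightThetaFrame Θ c F) ∧
    ∀ (Λ₀ : Finset ℕ) (Λ : Subgroup G) (Λ' : Subgroup (PontryaginDual G))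
      (B : G ≃ₜ* G) (C : PontryaginDual G ≃ₜ* PontryaginDual G) (φ : Λ₀ → MatGabor.L2 μ),
      IsLattice Λ → IsLattice Λ' →
      MatGabor.IsParsevalFrame (MatGabor.gaborSystem Λ Λ' B C φ) →
      MatGabor.IsTightMatFrame c
        (MatGabor.matGaborSystem Λ Λ' B C
          fun l => MatGabor.diagWindow n ((Real.sqrt c : ℂ) • φ l)) ∧
      MatGabor.IsTightThetaFrame Θ c fun p =>
        Θ (MatGabor.matGaborSystem Λ Λ' B C
          (fun l => MatGabor.diagWindow n ((Real.sqrt c : ℂ) • φ l)) p) := by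
  refine ⟨?_, fun Λ₀ Λ Λ' B C φ _ _ hφ => ?_⟩
  · obtain ⟨F, hF⟩ := MatGabor.exists_isParsevalFrame_nat (μ := μ)
    exact ⟨_, hF.isTightThetaFrame hΘ hadj hc⟩
  · rw [MatGabor.matGaborSystem_diagWindow]
    exact ⟨hφ.isTightMatFrame hc, hφ.isTightThetaFrame hΘ hadj hc⟩
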